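/- **Lemma (Finiteness and sample-continuity).** Let $X$ be a non-negative stochastic process on $\mathbb{R}^d$ with continuous sample paths and law $\mathbb{P}_X$ on the space $\mathbb{X}$ of non-negative continuous functions on $\mathbb{R}^d$ (with the topology of locally uniform convergence), let $\Psi$ be a (jointly measurable) non-negative stochastic process on $\mathbb{R}^d$, and let $\mu_Y>0$. Let $N$ be a Cox process on $\mathbb{R}^d\times(0,\infty]\times\mathbb{X}$ directed by the random measure $$\mathrm{d}\Lambda(s,u,X)=\mu_Y^{-1}\,\Psi(s)\,\mathrm{d}s\;u^{-2}\,\mathrm{d}u\;\mathrm{d}\mathbb{P}_X ,$$ that is, conditionally on $\Lambda=\lambda$, $N$ is a Poisson process with directing measure $\lambda$. Let $N=\sum_{i}\delta_{(s_i,u_i,X_i)}$ be an enumeration of its (finitely or infinitely many) points by $i=1,2,\dots$, and put $$Y(t)=\bigvee_{i} u_i X_i(t-s_i)\in[0,\infty],\qquad t\in\mathbb{R}^d .$$ For a (not necessarily compact) set $K\subset\mathbb{R}^d$ consider the conditions $$\text{(a)}\quad \mathbb{E}_\Psi\,\mathbb{E}_X\int_{\mathbb{R}^d}\sup_{t\in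 K}X(t-s)\,\Psi(s)\,\mathrm{d}s<\infty ,$$ $$\text{(b)}\quad \text{almost surely there is an } n\in\mathbb{N} \text{ with } \inf_{t\in K}\bigvee_{i\le n}u_iX_i(t-s_i)>0 .$$ 1. If (a) holds for $K$, then $\sup_{t\in K}Y(t)<\infty$ almost surely. 2. If (a) and (b) hold for $K$, then almost surely the sample path of $Y$ is continuous on $K$. 3. If (a) and (b) hold for every compact $K\subset\mathbb{R}^d$, then almost surely: $\sup_{t\in K}Y(t)<\infty$ for every compact $K$; $Y$ is continuous on $\mathbb{R}^d$; and for every compact $K$ only finitely many points of $N$ contribute to $Y$ on $K$, i.e. the set $I_K$ of all $i$ with $u_iX_i(t-s_i)=Y(t)$ for some $t\in K$ is finite, and $Y(t)=\bigvee_{i\in I_K}u_iX_i(t-s_i)$ for all $t\in K$. -/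

import Mathlib

open MeasureTheory ProbabilityTheory Set
open scoped ENNReal NNReal

noncomputable section

namespace CoxExtremal

/-! ### Point processes, Poisson processes and Cox processes -/

section PointProcess

variable {S : Type*} [MeasurableSpace S] {Ω : Type*} [MeasurableSpace Ω]

/-- The counting measure `∑_{i < m} δ_{x i}`; the number `m` of points may be infinite. -/
def pointSum (m : ℕ∞) (x : ℕ → S) : Measure S :=
  Measure.sum fun i : {i : ℕ // (i : ℕ∞) < m} => Measure.dirac (x i)

/-- A point process: a measurable map into measures (with the `σ`-algebra generated by the
evaluations `ν ↦ ν B`) which is almost surely a countable sum of unit point masses. -/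
structure IsPointProcess (N : Ω → Measure S) (P : Measure Ω) : Prop where
  measurable : Measurable N
  counting : ∀ᵐ ω ∂P, ∃ (m : ℕ∞) (x : ℕ → S), N ω = pointSum m x

/-- A Poisson process with directing measure `ν`, on the probability space `(Ω, P)`. -/
structure IsPoissonProcess (N : Ω → Measure S) (ν : Measure S) (P : Measure Ω) : Prop
    extends IsPointProcess N P where
  count_law : ∀ B : Set S, MeasurableSet B → ν B ≠ ∞ →
    HasLaw (fun ω => N ω B) ((poissonMeasure (ν B).toNNReal).map (fun n : ℕ => (n : ℝ≥0∞))) P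
  indep : ∀ (n : ℕ) (B : Fin n → Set S), (∀ j, MeasurableSet (B j)) →
    Pairwise (fun j k => Disjoint (B j) (B k)) → iIndepFun (fun j ω => N ω (B j)) P

/-- A Cox process directed by the random measure `Λ`: a point process `N` with a regular
conditional distribution given `Λ = ν` which is, for almost every value `ν` of `Λ`, the law of a
Poisson process directed by `ν`. -/
structure IsCoxProcess (N : Ω → Measure S) (Λ : Ω → Measure S) (P : Measure Ω) : Prop
    extends IsPointProcess N P where
  measurable_directing : Measurable Λ
  conditional_poisson : ∃ κ : Kernel (Measure S) (Measure S), IsMarkovKernel κ ∧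
    HasCondDistrib N Λ κ P ∧ ∀ᵐ ν ∂(P.map Λ), IsPoissonProcess id ν (κ ν)

end PointProcess

/-! ### The space of storms and the directing measure -/

/-- The space `ℝ^d`. -/
abbrev Loc (d : ℕ) : Type := EuclideanSpace ℝ (Fin d)

/-- Non-negative continuous functions on `ℝ^d`, with the topology of locally uniform
convergence (the compact-open topology). -/
abbrev Storm (d : ℕ) : Type := C(Loc d, ℝ≥0)

instance (d : ℕ) : MeasurableSpace (Storm d) := borel _

instance (d : ℕ) : BorelSpace (Storm d) := ⟨rfl⟩

/-- The interval `(0, ∞]` of severities. -/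
abbrev Severity : Type := Ioc (0 : ℝ≥0∞) ⊤

/-- The space `ℝ^d × (0, ∞] × C(ℝ^d)` of triples (centre, severity, shape). -/
abbrev Point (d : ℕ) : Type := Loc d × Severity × Storm d

/-- The measure `u⁻² du` on `(0, ∞]`; it does not charge `∞`. -/
def severityMeasure : Measure Severity :=
  ((Measure.comap Subtype.val (volume : Measure ℝ)).withDensity
    (fun u : Ioi (0 : ℝ) => ENNReal.ofReal ((u : ℝ) ^ 2)⁻¹)).map
      (fun u : Ioi (0 : ℝ) => ⟨ENNReal.ofReal (u : ℝ), ENNReal.ofReal_pos.2 u.2, le_top⟩)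

instance : SFinite severityMeasure := by
  have : SigmaFinite (Measure.comap (Subtype.val : Ioi (0 : ℝ) → ℝ) volume) := by
    apply SigmaFinite.of_map _ measurable_subtype_coe.aemeasurable
    rw [(MeasurableEmbedding.subtype_coe measurableSet_Ioi).map_comap]
    infer_instance
  unfold severityMeasure
  infer_instance

/-- The measure `μ⁻¹ ψ(s) ds u⁻² du dP_X` on the space of triples. -/
def directing {d : ℕ} (μ : ℝ≥0) (ψ : Loc d → ℝ≥0) (PX : Measure (Storm d)) :
    Measure (Point d) :=
  (μ : ℝ≥0∞)⁻¹ •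
    ((volume.withDensity (fun s => (ψ s : ℝ≥0∞))).prod (severityMeasure.prod PX))

/-! ### The extremal field -/

/-- The contribution `u X(t - s)` of the triple `(s, u, X)` at the location `t`. -/
def contribution {d : ℕ} (x : Point d) (t : Loc d) : ℝ≥0∞ :=
  (x.2.1 : ℝ≥0∞) * (x.2.2 (t - x.1) : ℝ≥0∞)

/-- The field `Y(t) = ⋁_{i < m} u_i X_i(t - s_i)` of a configuration with `m ≤ ∞` points
`x i = (s_i, u_i, X_i)`. -/
def field {d : ℕ} (m : ℕ∞) (x : ℕ → Point d) (t : Loc d) : ℝ≥0∞ :=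
  ⨆ (i : ℕ) (_ : (i : ℕ∞) < m), contribution (x i) t

/-- The maximum over (at most) the first `n` points of a configuration. -/
def partialField {d : ℕ} (m : ℕ∞) (x : ℕ → Point d) (n : ℕ) (t : Loc d) : ℝ≥0∞ :=
  ⨆ (i : ℕ) (_ : i < n) (_ : (i : ℕ∞) < m), contribution (x i) t

/-- The (indices of the) points of a configuration that contribute to the field on `K`: those
which attain the maximum at some location in `K`. -/
def contributors {d : ℕ} (m : ℕ∞) (x : ℕ → Point d) (K : Set (Loc d)) : Set ℕ :=
  {i | (i : ℕ∞) < m ∧ ∃ t ∈ K, contribution (x i) t = field m x t}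

variable {Ω : Type*} [MeasurableSpace Ω]

/-- `E_Ψ E_X ∫ sup_{t ∈ K} X(t - s) Ψ(s) ds < ∞`. -/
def IntegrabilityCondition {d : ℕ} (P : Measure Ω) (Ψ : Ω → Loc d → ℝ≥0)
    (PX : Measure (Storm d)) (K : Set (Loc d)) : Prop :=
  (∫⁻ ω, ∫⁻ X, ∫⁻ s, (⨆ t ∈ K, (X (t - s) : ℝ≥0∞) * (Ψ ω s : ℝ≥0∞)) ∂volume ∂PX ∂P) < ∞

/-- Almost surely there is an `n` with `inf_{t ∈ K} ⋁_{i < n} u_i X_i(t - s_i) > 0`. -/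
def PositivityCondition {d : ℕ} (P : Measure Ω) (M : Ω → ℕ∞) (x : Ω → ℕ → Point d)
    (K : Set (Loc d)) : Prop :=
  ∀ᵐ ω ∂P, ∃ n : ℕ, 0 < ⨅ t ∈ K, partialField (M ω) (x ω) n t

end CoxExtremal

end

/-!
By Campbell's formula the mean measure of `N` is `E Λ`, and since `∫_{c/g}^∞ u⁻² du = g / c`, the
expected number of points whose contribution exceeds a level `c > 0` somewhere on `K` is at most
`C / c`, where `μ_Y C` is the integral in (a). Almost surely, therefore, only finitely many
contributions exceed any given positive level, and, letting `c → ∞`, each of them is bounded on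
`K`. So `max c Y` is a maximum of finitely many continuous functions for every `c > 0`, which gives
the boundedness and the continuity of `Y`; and where `Y` is bounded away from zero, only the
finitely many points exceeding some fixed level can attain the supremum.
-/

namespace CoxExtremal

open Filter Topology

/-! ### Suprema of tame families of functions -/

section TameFamily

theorem tendsto_of_forall_tendsto_max {α β : Type*} [LinearOrder β] [OrderBot β]
    [DenselyOrdered β] [TopologicalSpace β] [OrderTopology β] {g : α → β} {l : Filter α} {b : β}
    (h : ∀ c, ⊥ < c → Tendsto (fun t => max c (g t)) l (𝓝 (max c b))) : Tendsto g l (𝓝 b) := by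
  refine tendsto_order.2 ⟨fun a hab => ?_, fun a hba => ?_⟩
  · obtain ⟨c, hac, hcb⟩ := exists_between hab
    filter_upwards [(h c (bot_le.trans_lt hac)).eventually_const_lt
      (hcb.trans_le (le_max_right c b))] with t ht
    exact hac.trans ((lt_max_iff.1 ht).resolve_left (lt_irrefl c))
  · obtain ⟨c, hbc, hca⟩ := exists_between hba
    filter_upwards [(h c (bot_le.trans_lt hbc)).eventually_lt_const (max_lt hca hba)] with t ht
    exact (le_max_right c (g t)).trans_lt ht

variable {ι α β : Type*} [CompleteLinearOrder β]

/-- The indices in `I` of the functions that exceed the level `c` somewhere on `K`. -/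
def exceedances (I : Set ι) (f : ι → α → β) (K : Set α) (c : β) : Set ι :=
  {i ∈ I | ∃ t ∈ K, c < f i t}

/-- The indices in `I` of the functions that attain the pointwise supremum of the family `(f i)`,
`i ∈ I`, somewhere on `K`. -/
def maximizers (I : Set ι) (f : ι → α → β) (K : Set α) : Set ι :=
  {i ∈ I | ∃ t ∈ K, f i t = ⨆ j ∈ I, f j t}

/-- A family of functions `f i`, `i ∈ I`, is tame on `K` if each of them is bounded on `K` and only
finitely many of them exceed any given positive level somewhere on `K`. Here `⊥` plays the role of
zero and `⊤` that of infinity. -/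
structure IsTameOn (I : Set ι) (f : ι → α → β) (K : Set α) : Prop where
  finite_exceedances : ∀ c, ⊥ < c → (exceedances I f K c).Finite
  biSup_lt_top : ∀ i ∈ I, ⨆ t ∈ K, f i t < ⊤

variable {I : Set ι} {f : ι → α → β} {K : Set α}

theorem max_iSup_exceedances (c : β) {t : α} (ht : t ∈ K) :
    max c (⨆ i ∈ exceedances I f K c, f i t) = max c (⨆ i ∈ I, f i t) := by
  refine le_antisymm (max_le_max_left c (biSup_mono fun _ hi => hi.1))
    (max_le (le_max_left _ _) (iSup₂_le fun i hi => ?_))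
  by_cases hci : c < f i t
  · exact le_max_of_le_right (le_iSup₂_of_le i ⟨hi, t, ht, hci⟩ le_rfl)
  · exact le_max_of_le_left (not_lt.1 hci)

namespace IsTameOn

theorem mono {K' : Set α} (h : IsTameOn I f K') (hK : K ⊆ K') : IsTameOn I f K where
  finite_exceedances c hc := (h.finite_exceedances c hc).subset
    fun _ ⟨hi, t, ht, hct⟩ => ⟨hi, t, hK ht, hct⟩
  biSup_lt_top i hi := (biSup_mono hK).trans_lt (h.biSup_lt_top i hi)

theorem iSup_lt_top [DenselyOrdered β] [Nontrivial β] (h : IsTameOn I f K) :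
    ⨆ t ∈ K, ⨆ i ∈ I, f i t < ⊤ := by
  obtain ⟨c, hc, hc_top⟩ := exists_between (bot_lt_top (α := β))
  have hfin := h.finite_exceedances c hc
  have hlt : hfin.toFinset.sup (fun i => ⨆ t ∈ K, f i t) < ⊤ :=
    (Finset.sup_lt_iff bot_lt_top).2 fun i hi => h.biSup_lt_top i (hfin.mem_toFinset.1 hi).1
  refine lt_of_le_of_lt (iSup₂_le fun t ht => ?_) (max_lt hc_top hlt)
  refine (le_max_right c _).trans ((max_iSup_exceedances c ht).symm.trans_le ?_)
  refine max_le_max_left c (iSup₂_le fun i hi => ?_)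
  exact (le_iSup₂_of_le t ht le_rfl).trans
    (Finset.le_sup (f := fun i => ⨆ t ∈ K, f i t) (hfin.mem_toFinset.2 hi))

theorem continuousOn_iSup [DenselyOrdered β] [TopologicalSpace β] [OrderTopology β]
    [TopologicalSpace α] (h : IsTameOn I f K) (hf : ∀ i ∈ I, ContinuousOn (f i) K) :
    ContinuousOn (fun t => ⨆ i ∈ I, f i t) K := by
  refine fun t ht => tendsto_of_forall_tendsto_max fun c hc => ?_
  have hfin := h.finite_exceedances c hc
  have hcont : ContinuousOn (fun t => max c (hfin.toFinset.sup fun i => f i t)) K :=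
    continuousOn_const.sup' (ContinuousOn.finset_sup_apply fun i hi =>
      hf i (hfin.mem_toFinset.1 hi).1)
  refine (hcont.congr fun s hs => ?_) t ht
  rw [← max_iSup_exceedances c hs, Finset.sup_eq_iSup]
  simp only [hfin.mem_toFinset]

theorem exists_eq_iSup [DenselyOrdered β] (h : IsTameOn I f K) {t : α} (ht : t ∈ K)
    (hpos : ⊥ < ⨆ i ∈ I, f i t) : ∃ i ∈ I, f i t = ⨆ j ∈ I, f j t := by
  obtain ⟨c, hc, hct⟩ := exists_between hpos
  obtain ⟨k, hk, hck⟩ := lt_biSup_iff.1 hct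
  obtain ⟨i, hi, hmax⟩ := Set.exists_max_image (exceedances I f K c) (f · t)
    (h.finite_exceedances c hc) ⟨k, hk, t, ht, hck⟩
  have hci : c < f i t := hck.trans_le (hmax k ⟨hk, t, ht, hck⟩)
  refine ⟨i, hi.1, le_antisymm (le_iSup₂_of_le i hi.1 le_rfl) (iSup₂_le fun j hj => ?_)⟩
  by_cases hcj : c < f j t
  · exact hmax j ⟨hj, t, ht, hcj⟩
  · exact (not_lt.1 hcj).trans hci.le

theorem iSup_eq_iSup_maximizers [DenselyOrdered β] (h : IsTameOn I f K) {t : α} (ht : t ∈ K) :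
    ⨆ i ∈ I, f i t = ⨆ i ∈ maximizers I f K, f i t := by
  refine le_antisymm ?_ (biSup_mono fun _ hi => hi.1)
  rcases eq_bot_or_bot_lt (⨆ i ∈ I, f i t) with hbot | hpos
  · exact hbot.trans_le bot_le
  · obtain ⟨i, hi, hit⟩ := h.exists_eq_iSup ht hpos
    exact le_iSup₂_of_le i ⟨hi, t, ht, hit⟩ hit.ge

theorem finite_maximizers [DenselyOrdered β] [TopologicalSpace β] [OrderTopology β]
    [TopologicalSpace α] (h : IsTameOn I f K) (hf : ∀ i ∈ I, ContinuousOn (f i) K)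
    (hK : IsCompact K) (hpos : ∀ t ∈ K, ⊥ < ⨆ i ∈ I, f i t) : (maximizers I f K).Finite := by
  rcases K.eq_empty_or_nonempty with rfl | hne
  · simp [maximizers]
  obtain ⟨t₀, ht₀, hmin⟩ := hK.exists_isMinOn hne (h.continuousOn_iSup hf)
  obtain ⟨c, hc, hct₀⟩ := exists_between (hpos t₀ ht₀)
  refine (h.finite_exceedances c hc).subset fun i ⟨hi, t, ht, hit⟩ => ⟨hi, t, ht, ?_⟩
  exact hit ▸ hct₀.trans_le (hmin ht)

end IsTameOn

end TameFamily

/-! ### First moments of point processes -/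

theorem succ_mul_poissonMeasure_singleton (r : ℝ≥0) (n : ℕ) :
    ((n + 1 : ℕ) : ℝ≥0∞) * poissonMeasure r {n + 1} = r * poissonMeasure r {n} := by
  rw [poissonMeasure_singleton, poissonMeasure_singleton, ← ENNReal.ofReal_natCast,
    ← ENNReal.ofReal_mul (by positivity), ← ENNReal.ofReal_coe_nnreal,
    ← ENNReal.ofReal_mul (by positivity), Nat.factorial_succ, pow_succ]
  congr 1
  push_cast
  field_simp

theorem lintegral_natCast_poissonMeasure (r : ℝ≥0) :
    ∫⁻ n : ℕ, (n : ℝ≥0∞) ∂(poissonMeasure r) = r := by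
  calc ∫⁻ n : ℕ, (n : ℝ≥0∞) ∂(poissonMeasure r)
      = ∑' n : ℕ, r * poissonMeasure r {n} := by
        rw [lintegral_countable', tsum_eq_zero_add' ENNReal.summable]
        simp only [Nat.cast_zero, zero_mul, zero_add, succ_mul_poissonMeasure_singleton]
    _ = r * ∫⁻ _, 1 ∂(poissonMeasure r) := by
        simp only [ENNReal.tsum_mul_left, lintegral_countable', one_mul]
    _ = r := by simp only [lintegral_one, measure_univ, mul_one]

theorem ae_lt_top_of_measure_lt_le_div {S : Type*} [MeasurableSpace S] {ν : Measure S}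
    {F : S → ℝ≥0∞} {C : ℝ≥0∞} (hC : C ≠ ∞)
    (h : ∀ c, c ≠ 0 → c ≠ ∞ → ν {y | c < F y} ≤ C / c) : ∀ᵐ y ∂ν, F y < ∞ := by
  have hlim : Tendsto (fun n : ℕ => C / (n : ℝ≥0∞)) atTop (𝓝 0) := by
    simpa only [ENNReal.div_top] using
      ENNReal.Tendsto.const_div ENNReal.tendsto_nat_nhds_top (Or.inr hC)
  refine le_antisymm (ge_of_tendsto hlim ?_) bot_le
  filter_upwards [eventually_ne_atTop 0] with n hn
  refine (measure_mono fun y hy => ?_).trans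
    (h n (Nat.cast_ne_zero.2 hn) (ENNReal.natCast_ne_top n))
  exact (ENNReal.natCast_lt_top n).trans_le (not_lt.1 hy)

section PointProcess

variable {S : Type*} [MeasurableSpace S] {Ω : Type*} [MeasurableSpace Ω] {P : Measure Ω}

theorem IsPoissonProcess.bind_le {N : Ω → Measure S} {ν : Measure S}
    (h : IsPoissonProcess N ν P) : P.bind N ≤ ν := by
  refine Measure.le_iff.2 fun B hB => ?_
  rcases eq_or_ne (ν B) ∞ with hν | hν
  · exact hν ▸ le_top
  have hlaw := h.count_law B hB hν
  refine le_of_eq ?_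
  calc P.bind N B = ∫⁻ ω, N ω B ∂P := Measure.bind_apply hB h.measurable.aemeasurable
    _ = ∫⁻ y, y ∂(P.map fun ω => N ω B) :=
        (lintegral_map' measurable_id.aemeasurable hlaw.aemeasurable).symm
    _ = ∫⁻ n : ℕ, (n : ℝ≥0∞) ∂(poissonMeasure (ν B).toNNReal) := by
        rw [hlaw.map_eq, lintegral_map (f := fun y => y) measurable_id .of_discrete]
    _ = ν B := by rw [lintegral_natCast_poissonMeasure, ENNReal.coe_toNNReal hν]

theorem IsCoxProcess.bind_le [SFinite P] {N Λ : Ω → Measure S} (h : IsCoxProcess N Λ P) :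
    P.bind N ≤ P.bind Λ := by
  obtain ⟨κ, hκ, hcond, hpois⟩ := h.conditional_poisson
  have hlaw : P.map N = (P.map Λ).bind κ := by
    rw [← Measure.snd_compProd, ← hcond.map_eq, Measure.snd_map_prodMk h.measurable_directing]
  calc P.bind N
      = ((P.map Λ).bind κ).bind id := by rw [← hlaw, Measure.bind, Measure.bind, Measure.map_id]
    _ = (P.map Λ).bind fun ν => (κ ν).bind id :=
        Measure.bind_bind κ.measurable.aemeasurable measurable_id.aemeasurable
    _ ≤ (P.map Λ).bind id := by
        refine Measure.le_iff.2 fun B hB => (Measure.bind_apply_le _ hB).trans ?_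
        rw [Measure.bind_apply hB measurable_id.aemeasurable]
        refine lintegral_mono_ae ?_
        filter_upwards [hpois] with ν hν using hν.bind_le B
    _ = P.bind Λ := by rw [Measure.bind, Measure.map_id, Measure.bind]

theorem ae_pointSum_iff {m : ℕ∞} {x : ℕ → S} {p : S → Prop} (hp : MeasurableSet {y | p y}) :
    (∀ᵐ y ∂(pointSum m x), p y) ↔ ∀ i : ℕ, (i : ℕ∞) < m → p (x i) := by
  simp only [pointSum, Measure.ae_sum_iff, ae_dirac_iff hp, Subtype.forall]

theorem pointSum_lt_top_iff {m : ℕ∞} {x : ℕ → S} {B : Set S} (hB : MeasurableSet B) :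
    pointSum m x B < ∞ ↔ {i : ℕ | (i : ℕ∞) < m ∧ x i ∈ B}.Finite := by
  have hmap : pointSum m x =
      Measure.count.map fun i : {i : ℕ // (i : ℕ∞) < m} => x i := by
    rw [Measure.count, Measure.map_sum .of_discrete]
    simp only [pointSum, Measure.map_dirac' .of_discrete]
  rw [hmap, Measure.map_apply .of_discrete hB, Measure.count_apply_lt_top' .of_discrete,
    ← Set.finite_image_iff Subtype.val_injective.injOn]
  congr! 1
  ext i
  simp [and_comm]

theorem ae_lt_top_of_bind_lt_top {N : Ω → Measure S} (hN : AEMeasurable N P) {B : Set S}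
    (hB : MeasurableSet B) (h : P.bind N B < ∞) : ∀ᵐ ω ∂P, N ω B < ∞ :=
  ae_lt_top' ((Measure.measurable_coe hB).comp_aemeasurable hN)
    (Measure.bind_apply hB hN ▸ h).ne

theorem ae_isTameOn_of_bind_le_div {α : Type*} {F : S → α → ℝ≥0∞} {K : Set α}
    (hF : Measurable fun y => ⨆ t ∈ K, F y t) {N : Ω → Measure S} (hN : AEMeasurable N P)
    {M : Ω → ℕ∞} {x : Ω → ℕ → S} (hx : ∀ᵐ ω ∂P, N ω = pointSum (M ω) (x ω))
    {C : ℝ≥0∞} (hC : C ≠ ∞)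
    (hbound : ∀ c, c ≠ 0 → c ≠ ∞ → P.bind N {y | c < ⨆ t ∈ K, F y t} ≤ C / c) :
    ∀ᵐ ω ∂P, IsTameOn {i : ℕ | (i : ℕ∞) < M ω} (fun i => F (x ω i)) K := by
  have hlevel : ∀ c, MeasurableSet {y | c < ⨆ t ∈ K, F y t} :=
    fun c => measurableSet_lt measurable_const hF
  have hfinite : ∀ᵐ ω ∂P, ∀ n : ℕ, N ω {y | ((n : ℝ≥0∞) + 1)⁻¹ < ⨆ t ∈ K, F y t} < ∞ := by
    refine ae_all_iff.2 fun n => ae_lt_top_of_bind_lt_top hN (hlevel _) ?_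
    have hn : ((n : ℝ≥0∞) + 1)⁻¹ ≠ 0 := by simp
    exact (hbound _ hn (by simp)).trans_lt (ENNReal.div_lt_top hC hn)
  have hbounded : ∀ᵐ ω ∂P, ∀ᵐ y ∂(N ω), ⨆ t ∈ K, F y t < ∞ :=
    Measure.ae_ae_of_ae_bind hN (ae_lt_top_of_measure_lt_le_div hC hbound)
  filter_upwards [hx, hfinite, hbounded] with ω hω hfin hbdd
  rw [hω] at hbdd
  refine ⟨fun c hc => ?_, (ae_pointSum_iff (measurableSet_lt hF measurable_const)).1 hbdd⟩
  obtain ⟨n, hn⟩ := ENNReal.exists_inv_nat_lt hc.ne'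
  have hfin_n := (pointSum_lt_top_iff (hlevel _)).1 (hω ▸ hfin n)
  refine hfin_n.subset fun i ⟨hi, hci⟩ => ⟨hi, lt_of_le_of_lt ?_ (hn.trans (lt_biSup_iff.2 hci))⟩
  exact ENNReal.inv_le_inv.2 le_self_add

theorem ae_forall_isCompact {α : Type*} [TopologicalSpace α] [WeaklyLocallyCompactSpace α]
    [SigmaCompactSpace α] {p : Ω → Set α → Prop}
    (hmono : ∀ ω K K', K ⊆ K' → p ω K' → p ω K)
    (h : ∀ K, IsCompact K → ∀ᵐ ω ∂P, p ω K) : ∀ᵐ ω ∂P, ∀ K, IsCompact K → p ω K := by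
  let E : CompactExhaustion α := default
  filter_upwards [ae_all_iff.2 fun n => h (E n) (E.isCompact n)] with ω hω K hK
  obtain ⟨n, hn⟩ := E.exists_superset_of_isCompact hK
  exact hmono ω K (E n) hn (hω n)

end PointProcess

/-! ### The directing measure -/

theorem lintegral_Ioi_ofReal_inv_sq {a : ℝ} (ha : 0 < a) :
    ∫⁻ t in Ioi a, ENNReal.ofReal (t ^ 2)⁻¹ = (ENNReal.ofReal a)⁻¹ := by
  have hpow : EqOn (fun t : ℝ => t ^ (-2 : ℝ)) (fun t => (t ^ 2)⁻¹) (Ioi a) := fun t ht => by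
    simp only [Real.rpow_neg (ha.trans ht).le, Real.rpow_ofNat]
  have hint : IntegrableOn (fun t : ℝ => (t ^ 2)⁻¹) (Ioi a) :=
    (integrableOn_Ioi_rpow_of_lt (by norm_num) ha).congr_fun hpow measurableSet_Ioi
  rw [← ofReal_integral_eq_lintegral_ofReal hint (ae_of_all _ fun t => by positivity),
    ← setIntegral_congr_fun measurableSet_Ioi hpow, integral_Ioi_rpow_of_lt (by norm_num) ha,
    ← ENNReal.ofReal_inv_of_pos ha]
  norm_num [Real.rpow_neg_one]

theorem severityMeasure_setOf_lt {a : ℝ≥0∞} (ha : a ≠ 0) :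
    severityMeasure {u : Severity | a < u} = a⁻¹ := by
  rcases eq_or_ne a ∞ with rfl | ha'
  · simp
  have ha_pos : 0 < a.toReal := ENNReal.toReal_pos ha ha'
  have hmeas : Measurable fun u : Ioi (0 : ℝ) =>
      (⟨ENNReal.ofReal (u : ℝ), ENNReal.ofReal_pos.2 u.2, le_top⟩ : Severity) := by
    fun_prop
  have hset : MeasurableSet {u : Severity | a < u} :=
    measurableSet_lt measurable_const measurable_subtype_coe
  have hpre : (fun u : Ioi (0 : ℝ) =>
      (⟨ENNReal.ofReal (u : ℝ), ENNReal.ofReal_pos.2 u.2, le_top⟩ : Severity)) ⁻¹'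
        {u : Severity | a < u} = Subtype.val ⁻¹' Ioi a.toReal := by
    ext u
    simp only [mem_preimage, mem_ofPred_eq, mem_Ioi, ENNReal.lt_ofReal_iff_toReal_lt ha']
  have hemb := MeasurableEmbedding.subtype_coe (measurableSet_Ioi (a := (0 : ℝ)))
  rw [severityMeasure, Measure.map_apply hmeas hset, withDensity_apply _ (hmeas hset), hpre,
    ← hemb.lintegral_map (fun u : ℝ => ENNReal.ofReal (u ^ 2)⁻¹), ← hemb.restrict_map,
    hemb.map_comap, Subtype.range_val, Measure.restrict_restrict measurableSet_Ioi,
    inter_eq_left.2 (Ioi_subset_Ioi ha_pos.le), lintegral_Ioi_ofReal_inv_sq ha_pos,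
    ENNReal.ofReal_toReal ha']

theorem severityMeasure_setOf_lt_mul_le (g : ℝ≥0∞) {c : ℝ≥0∞} (hc : c ≠ 0) (hc' : c ≠ ∞) :
    severityMeasure {u : Severity | c < u * g} ≤ g / c := by
  rcases eq_or_ne g ∞ with rfl | hg
  · exact (ENNReal.top_div_of_ne_top hc').symm ▸ le_top
  calc severityMeasure {u : Severity | c < u * g}
      ≤ severityMeasure {u : Severity | c / g < u} :=
        measure_mono fun _ hu => ENNReal.div_lt_of_lt_mul hu
    _ = (c / g)⁻¹ := severityMeasure_setOf_lt (ENNReal.div_ne_zero.2 ⟨hc, hg⟩)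
    _ = g / c := ENNReal.inv_div (Or.inr hc') (Or.inr hc)

theorem prod_severityMeasure_prod_setOf_lt_mul_le {A E : Type*} [MeasurableSpace A]
    [MeasurableSpace E] (σ : Measure A) (ρ : Measure E) [SFinite ρ] {g : A × E → ℝ≥0∞}
    (hg : Measurable g) {c : ℝ≥0∞} (hc : c ≠ 0) (hc' : c ≠ ∞) :
    σ.prod (severityMeasure.prod ρ) {x | c < x.2.1 * g (x.1, x.2.2)} ≤
      (∫⁻ p, g p ∂(σ.prod ρ)) / c := by
  have hset : MeasurableSet {x : A × Severity × E | c < x.2.1 * g (x.1, x.2.2)} :=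
    measurableSet_lt measurable_const (by fun_prop)
  calc σ.prod (severityMeasure.prod ρ) {x | c < x.2.1 * g (x.1, x.2.2)}
      = ∫⁻ s, ∫⁻ X, severityMeasure {u : Severity | c < u * g (s, X)} ∂ρ ∂σ := by
        rw [Measure.prod_apply hset]
        refine lintegral_congr fun s => Measure.prod_apply_symm (measurable_prodMk_left hset)
    _ ≤ ∫⁻ s, ∫⁻ X, g (s, X) / c ∂ρ ∂σ :=
        lintegral_mono fun _ => lintegral_mono fun _ => severityMeasure_setOf_lt_mul_le _ hc hc'
    _ = ∫⁻ p, g p / c ∂(σ.prod ρ) := (lintegral_prod _ (hg.div_const c).aemeasurable).symm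
    _ = (∫⁻ p, g p ∂(σ.prod ρ)) / c := by
        simp only [div_eq_mul_inv, lintegral_mul_const' _ _ (ENNReal.inv_ne_top.2 hc)]

section Storms

variable {d : ℕ}

/-- The supremum over `K` of the shape `X` centred at `s`, as a function of `p = (s, X)`. -/
noncomputable def peak (K : Set (Loc d)) (p : Loc d × Storm d) : ℝ≥0∞ :=
  ⨆ t ∈ K, (p.2 (t - p.1) : ℝ≥0∞)

@[fun_prop]
theorem measurable_peak (K : Set (Loc d)) : Measurable (peak K) := by
  refine LowerSemicontinuous.measurable (lowerSemicontinuous_biSup fun t _ => ?_)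
  refine Continuous.lowerSemicontinuous (ENNReal.continuous_coe.comp ?_)
  fun_prop

theorem iSup_contribution_eq_mul_peak (K : Set (Loc d)) (y : Point d) :
    ⨆ t ∈ K, contribution y t = y.2.1 * peak K (y.1, y.2.2) := by
  simp only [contribution, peak, ENNReal.mul_iSup]

theorem measurable_iSup_contribution (K : Set (Loc d)) :
    Measurable fun y : Point d => ⨆ t ∈ K, contribution y t := by
  simp only [iSup_contribution_eq_mul_peak]
  fun_prop

theorem directing_setOf_lt_iSup_contribution_le (μ : ℝ≥0) {ψ : Loc d → ℝ≥0} (hψ : Measurable ψ)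
    (PX : Measure (Storm d)) [SFinite PX] (K : Set (Loc d)) {c : ℝ≥0∞} (hc : c ≠ 0)
    (hc' : c ≠ ∞) :
    directing μ ψ PX {y | c < ⨆ t ∈ K, contribution y t} ≤
      (μ : ℝ≥0∞)⁻¹ *
        ((∫⁻ X, ∫⁻ s, (⨆ t ∈ K, (X (t - s) : ℝ≥0∞) * (ψ s : ℝ≥0∞)) ∂volume ∂PX) / c) := by
  simp only [iSup_contribution_eq_mul_peak, directing, Measure.smul_apply, smul_eq_mul]
  gcongr
  refine (prod_severityMeasure_prod_setOf_lt_mul_le _ PX (measurable_peak K) hc hc').trans_eq ?_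
  rw [lintegral_prod_symm' _ (measurable_peak K)]
  congr! 3 with X
  rw [lintegral_withDensity_eq_lintegral_mul _ (by fun_prop) (by fun_prop)]
  simp only [Pi.mul_apply, peak, ENNReal.mul_iSup, mul_comm]

theorem bind_directing_setOf_lt_iSup_contribution_le {Ω : Type*} [MeasurableSpace Ω]
    (P : Measure Ω) {μ : ℝ≥0} (hμ : 0 < μ) {Ψ : Ω → Loc d → ℝ≥0} (hΨ : ∀ ω, Measurable (Ψ ω))
    (PX : Measure (Storm d)) [SFinite PX] (K : Set (Loc d)) {c : ℝ≥0∞} (hc : c ≠ 0)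
    (hc' : c ≠ ∞) :
    (P.bind fun ω => directing μ (Ψ ω) PX) {y | c < ⨆ t ∈ K, contribution y t} ≤
      (μ : ℝ≥0∞)⁻¹ *
        (∫⁻ ω, ∫⁻ X, ∫⁻ s, (⨆ t ∈ K, (X (t - s) : ℝ≥0∞) * (Ψ ω s : ℝ≥0∞)) ∂volume ∂PX ∂P) / c := by
  have hlevel : MeasurableSet {y : Point d | c < ⨆ t ∈ K, contribution y t} :=
    measurableSet_lt measurable_const (measurable_iSup_contribution K)
  have hμ_inv : (μ : ℝ≥0∞)⁻¹ ≠ ∞ := ENNReal.inv_ne_top.2 (ENNReal.coe_ne_zero.2 hμ.ne')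
  refine (Measure.bind_apply_le _ hlevel).trans ((lintegral_mono fun ω =>
    directing_setOf_lt_iSup_contribution_le μ (hΨ ω) PX K hc hc').trans_eq ?_)
  simp only [div_eq_mul_inv, lintegral_const_mul' _ _ hμ_inv,
    lintegral_mul_const' _ _ (ENNReal.inv_ne_top.2 hc), mul_assoc]

/-! ### The extremal field -/

theorem continuousOn_contribution {K : Set (Loc d)} {y : Point d}
    (hy : ⨆ t ∈ K, contribution y t < ∞) : ContinuousOn (contribution y) K := by
  by_cases htop : (y.2.1 : ℝ≥0∞) = ∞
  · -- Since `∞ * a` is `0` or `∞`, a bounded contribution of infinite severity vanishes on `K`.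
    refine (continuousOn_const (c := 0)).congr fun t ht => ?_
    have hlt : contribution y t < ∞ := (le_iSup₂_of_le t ht le_rfl).trans_lt hy
    rw [contribution, htop] at hlt ⊢
    by_contra hne
    exact hlt.ne (ENNReal.top_mul (right_ne_zero_of_mul hne))
  · refine ((ENNReal.continuous_const_mul htop).comp
      (ENNReal.continuous_coe.comp ?_)).continuousOn
    fun_prop

theorem partialField_le_field (m : ℕ∞) (x : ℕ → Point d) (n : ℕ) (t : Loc d) :
    partialField m x n t ≤ field m x t :=
  iSup_mono fun _ => iSup_le fun _ => le_rfl

theorem ae_forall_field_pos {Ω : Type*} [MeasurableSpace Ω] {P : Measure Ω} {M : Ω → ℕ∞}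
    {x : Ω → ℕ → Point d} (h : ∀ K, IsCompact K → PositivityCondition P M x K) :
    ∀ᵐ ω ∂P, ∀ t, 0 < field (M ω) (x ω) t := by
  have hcompact : ∀ᵐ ω ∂P, ∀ K, IsCompact K → ∀ t ∈ K, 0 < field (M ω) (x ω) t := by
    refine ae_forall_isCompact (fun _ _ _ hK hpos t ht => hpos t (hK ht)) fun K hK => ?_
    filter_upwards [h K hK] with ω ⟨n, hn⟩ t ht
    exact hn.trans_le ((iInf₂_le t ht).trans (partialField_le_field _ _ n t))
  filter_upwards [hcompact] with ω hω t using hω {t} isCompact_singleton t rfl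

end Storms

end CoxExtremal

open CoxExtremal in
theorem mainTheorem5_general {d : ℕ} {Ω : Type*} [MeasurableSpace Ω] (P : Measure Ω)
    (PX : Measure (Storm d)) [SFinite PX]
    (Ψ : Ω → Loc d → ℝ≥0) (hΨ : Measurable (Function.uncurry Ψ)) (μ : ℝ≥0) (hμ : 0 < μ)
    (N : Ω → Measure (Point d)) (hN : AEMeasurable N P)
    (hmean : P.bind N ≤ P.bind fun ω => directing μ (Ψ ω) PX)
    (M : Ω → ℕ∞) (x : Ω → ℕ → Point d) (hx : ∀ᵐ ω ∂P, N ω = pointSum (M ω) (x ω)) :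
    (∀ K, IntegrabilityCondition P Ψ PX K → ∀ᵐ ω ∂P,
      ⨆ t ∈ K, field (M ω) (x ω) t < ∞ ∧ ContinuousOn (field (M ω) (x ω)) K) ∧
    ((∀ K, IsCompact K → IntegrabilityCondition P Ψ PX K) → ∀ᵐ ω ∂P,
      Continuous (field (M ω) (x ω)) ∧
      ∀ K, IsCompact K → ⨆ t ∈ K, field (M ω) (x ω) t < ∞ ∧
        ((∀ t ∈ K, 0 < field (M ω) (x ω) t) → (contributors (M ω) (x ω) K).Finite) ∧
        ∀ t ∈ K, field (M ω) (x ω) t =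
          ⨆ i ∈ contributors (M ω) (x ω) K, contribution (x ω i) t) := by
  have htame : ∀ K, IntegrabilityCondition P Ψ PX K → ∀ᵐ ω ∂P,
      IsTameOn {i : ℕ | (i : ℕ∞) < M ω} (fun i => contribution (x ω i)) K := fun K hK =>
    ae_isTameOn_of_bind_le_div (measurable_iSup_contribution K) hN hx
      (ENNReal.mul_ne_top (ENNReal.inv_ne_top.2 (ENNReal.coe_ne_zero.2 hμ.ne')) hK.ne)
      fun c hc hc' => (hmean _).trans (bind_directing_setOf_lt_iSup_contribution_le P hμ
        (fun ω => hΨ.of_uncurry_left) PX K hc hc')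
  have hcont : ∀ {ω K}, IsTameOn {i : ℕ | (i : ℕ∞) < M ω} (fun i => contribution (x ω i)) K →
      ∀ i ∈ {i : ℕ | (i : ℕ∞) < M ω}, ContinuousOn (contribution (x ω i)) K :=
    fun h i hi => continuousOn_contribution (h.biSup_lt_top i hi)
  refine ⟨fun K hK => ?_, fun hK => ?_⟩
  · filter_upwards [htame K hK] with ω h using ⟨h.iSup_lt_top, h.continuousOn_iSup (hcont h)⟩
  · filter_upwards [ae_forall_isCompact (fun _ _ _ hsub h => h.mono hsub)
      fun K hcpt => htame K (hK K hcpt)] with ω h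
    refine ⟨continuous_iff_continuousAt.2 fun t => ?_, fun K hcpt => ⟨(h K hcpt).iSup_lt_top,
      fun hpos => (h K hcpt).finite_maximizers (hcont (h K hcpt)) hcpt hpos,
      fun t ht => (h K hcpt).iSup_eq_iSup_maximizers ht⟩⟩
    have hball := h _ (isCompact_closedBall t 1)
    exact (hball.continuousOn_iSup (hcont hball)).continuousAt
      (Metric.closedBall_mem_nhds t one_pos)

theorem mainTheorem5 {d : ℕ} {Ω : Type*} [MeasurableSpace Ω]
    (P : Measure Ω) [IsProbabilityMeasure P]
    -- the law of the storm process
    (PX : Measure (CoxExtremal.Storm d)) [IsProbabilityMeasure PX]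
    -- the spatial intensity process and the scaling constant
    (Ψ : Ω → CoxExtremal.Loc d → ℝ≥0) (hΨ : Measurable (Function.uncurry Ψ))
    (μ : ℝ≥0) (hμ : 0 < μ)
    -- the Cox process and an enumeration of its points
    (N : Ω → Measure (CoxExtremal.Point d))
    (hN : CoxExtremal.IsCoxProcess N (fun ω => CoxExtremal.directing μ (Ψ ω) PX) P)
    (M : Ω → ℕ∞) (x : Ω → ℕ → CoxExtremal.Point d)
    (hx : ∀ᵐ ω ∂P, N ω = CoxExtremal.pointSum (M ω) (x ω)) :
    (∀ K : Set (CoxExtremal.Loc d), CoxExtremal.IntegrabilityCondition P Ψ PX K →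
      ∀ᵐ ω ∂P, (⨆ t ∈ K, CoxExtremal.field (M ω) (x ω) t) < ∞) ∧
    (∀ K : Set (CoxExtremal.Loc d), CoxExtremal.IntegrabilityCondition P Ψ PX K →
      CoxExtremal.PositivityCondition P M x K →
      ∀ᵐ ω ∂P, ContinuousOn (CoxExtremal.field (M ω) (x ω)) K) ∧
    ((∀ K : Set (CoxExtremal.Loc d), IsCompact K →
        CoxExtremal.IntegrabilityCondition P Ψ PX K ∧
        CoxExtremal.PositivityCondition P M x K) →
      ∀ᵐ ω ∂P,
        (∀ K : Set (CoxExtremal.Loc d), IsCompact K →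
          (⨆ t ∈ K, CoxExtremal.field (M ω) (x ω) t) < ∞) ∧
        Continuous (CoxExtremal.field (M ω) (x ω)) ∧
        (∀ K : Set (CoxExtremal.Loc d), IsCompact K →
          (CoxExtremal.contributors (M ω) (x ω) K).Finite ∧
          ∀ t ∈ K, CoxExtremal.field (M ω) (x ω) t =
            ⨆ i ∈ CoxExtremal.contributors (M ω) (x ω) K,
              CoxExtremal.contribution (x ω i) t)) := by
  obtain ⟨hfixed, hcompact⟩ := mainTheorem5_general P PX Ψ hΨ μ hμ N hN.measurable.aemeasurable
    hN.bind_le M x hx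
  refine ⟨fun K hK => (hfixed K hK).mono fun _ h => h.1,
    fun K hK _ => (hfixed K hK).mono fun _ h => h.2, fun hK => ?_⟩
  filter_upwards [hcompact fun K hcpt => (hK K hcpt).1,
    CoxExtremal.ae_forall_field_pos fun K hcpt => (hK K hcpt).2] with ω ⟨hcont, h⟩ hpos
  exact ⟨fun K hcpt => (h K hcpt).1, hcont,
    fun K hcpt => ⟨(h K hcpt).2.1 fun t _ => hpos t, (h K hcpt).2.2⟩⟩
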